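/- Let $S$ be a closed smooth surface, that is, a compact Hausdorff smooth $2$-manifold without boundary (not necessarily connected or orientable), and let $f\colon S\to\mathbb{R}^3$ be a smooth immersion (for instance, the inclusion of a closed surface $S\subset\mathbb{R}^3$). Let $\gamma\colon\mathbb{R}\to\mathbb{R}^3$ be a smooth closed curve, that is, a $C^\infty$ map with $\gamma(t+1)=\gamma(t)$ for all $t$; it may intersect itself. Suppose that $\gamma$ and $f$ are transverse: whenever $\gamma(t)=f(x)$, one has $\mathbb{R}\,\gamma'(t)+df_x(T_xS)=\mathbb{R}^3$. Then the number of intersections of the curve and the surface is finite and even, i.e. the set $$\{(t,x)\in[0,1)\times S : \gamma(t)=f(x)\}$$ is finite and has an even number of elements. Moreover, if distinct pairs $(t,x)$ of this set give distinct points $f(x)$ of $\mathbb{R}^3$ (in particular, if $f$ is an embedding and $\gamma$ is a simple closed curve), then the set of points $\gamma(\mathbb{R})\cap f(S)\subset\mathbb{R}^3$ is finite and has an even number of elements. -/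

import Mathlib

open Set Manifold
open scoped ContDiff

/-- A smooth closed curve in `ℝ³`, parametrised with period `1`; self-intersections are allowed. -/
structure IsSmoothClosedCurve (γ : ℝ → EuclideanSpace ℝ (Fin 3)) : Prop where
  contDiff : ContDiff ℝ ∞ γ
  periodic : Function.Periodic γ 1

section

variable {S : Type*} [TopologicalSpace S] [ChartedSpace (EuclideanSpace ℝ (Fin 2)) S]

/-- The pairs `(t, x)` of a parameter of the closed curve `γ`, taken in one period, and a point of
the surface `S` which `γ` and `f : S → ℝ³` send to the same point of `ℝ³`. -/
def intersectionPairs (γ : ℝ → EuclideanSpace ℝ (Fin 3)) (f : S → EuclideanSpace ℝ (Fin 3)) :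
    Set (ℝ × S) :=
  {p | p.1 ∈ Ico (0 : ℝ) 1 ∧ γ p.1 = f p.2}

/-- The curve `γ` and the surface `f : S → ℝ³` are transverse: wherever they meet, the tangent line
of the curve and the tangent plane of the surface together span `ℝ³`. -/
def CurveTransverse (γ : ℝ → EuclideanSpace ℝ (Fin 3)) (f : S → EuclideanSpace ℝ (Fin 3)) : Prop :=
  ∀ (t : ℝ) (x : S), γ t = f x →
    Submodule.span ℝ {deriv γ t} ⊔
      LinearMap.range (mfderiv (𝓡 2) 𝓘(ℝ, EuclideanSpace ℝ (Fin 3)) f x :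
        EuclideanSpace ℝ (Fin 2) →L[ℝ] EuclideanSpace ℝ (Fin 3)).toLinearMap = ⊤

end

open Filter Topology SignType

/-! ### Arithmetic of signs near a point. -/

section SignLemmas

/-! The idea is that a surface in `ℝ³` can be two-coloured: over a ball containing the curve there
is a sign function `s` that flips whenever one sheet is crossed. Following `s` once around the
closed curve returns the initial value, so the number of crossings, counted with sheets, is even. To
build `s`, take a local defining function of each sheet through `p` and multiply their signs
(`fiberSign`). Two defining functions of one sheet agree up to a sign, so the germs obtained at
neighbouring points are compatible up to a constant sign (`fiberSign_signGermEq`). They form a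
double cover, trivial over a ball; `exists_sign_function_on_ball` proves this directly, using only
convexity and a Lebesgue number. Neither orientability nor connectedness of the surface plays a
role. Transversality makes `s ∘ γ` behave like `± sign (t - t₀) ^ k` near `t₀`, where `k` is the
number of sheets through `γ t₀`. `even_sum_of_periodic_sign` then gives the parity. -/

theorem HasDerivAt.eventually_sign_eq {h : ℝ → ℝ} {h' t₀ : ℝ} (hd : HasDerivAt h h' t₀)
    (h0 : h t₀ = 0) (hne : h' ≠ 0) :
    ∀ᶠ t in 𝓝 t₀, sign (h t) = sign h' * sign (t - t₀) := by
  have hs := hasDerivAt_iff_tendsto_slope.1 hd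
  have key : ∀ᶠ t in 𝓝[≠] t₀, sign (slope h t₀ t) = sign h' := by
    rcases lt_or_gt_of_ne hne with hlt | hgt
    · filter_upwards [hs.eventually (gt_mem_nhds hlt)] with t ht
      rw [sign_neg ht, sign_neg hlt]
    · filter_upwards [hs.eventually (lt_mem_nhds hgt)] with t ht
      rw [sign_pos ht, sign_pos hgt]
  rw [eventually_nhdsWithin_iff] at key
  filter_upwards [key] with t ht
  by_cases hteq : t = t₀
  · simp [hteq, h0]
  · have h2 : h t = slope h t₀ t * (t - t₀) := by
      rw [slope_def_field, h0, sub_zero, div_mul_cancel₀ _ (sub_ne_zero.2 hteq)]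
    rw [h2, sign_mul, ht hteq]

theorem ContinuousAt.eventually_sign_eq {X : Type*} [TopologicalSpace X] {h : X → ℝ} {x : X}
    (hc : ContinuousAt h x) (hne : h x ≠ 0) : ∀ᶠ z in 𝓝 x, sign (h z) = sign (h x) := by
  rcases lt_or_gt_of_ne hne with hlt | hgt
  · filter_upwards [hc.eventually (gt_mem_nhds hlt)] with t ht
    rw [sign_neg ht, sign_neg hlt]
  · filter_upwards [hc.eventually (lt_mem_nhds hgt)] with t ht
    rw [sign_pos ht, sign_pos hgt]

theorem SignType.mul_self_of_ne_zero {a : SignType} (ha : a ≠ 0) : a * a = 1 := by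
  revert ha; revert a; decide

theorem SignType.mul_right_cancel_of_ne_zero {a b c : SignType} (hc : c ≠ 0)
    (h : a * c = b * c) : a = b := by
  revert a b c; decide

theorem SignType.eq_or_eq_neg_of_ne_zero {a b : SignType} (ha : a ≠ 0) (hb : b ≠ 0) :
    a = b ∨ a = -b := by
  revert a b; decide

theorem SignType.ne_neg_of_ne_zero {a : SignType} (ha : a ≠ 0) : a ≠ -a := by
  revert a; decide

theorem SignType.prod_ne_zero {ι : Type*} {s : Finset ι} {c : ι → SignType}
    (h : ∀ i ∈ s, c i ≠ 0) : ∏ i ∈ s, c i ≠ 0 :=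
  Finset.prod_induction c (· ≠ 0) (by decide) (by decide) h

theorem eventually_prod_eq_mul_prod {X ι : Type*} {l : Filter X} {s : Finset ι}
    {u v : ι → X → SignType}
    (h : ∀ i ∈ s, ∃ c : SignType, c ≠ 0 ∧ ∀ᶠ z in l, u i z = c * v i z) :
    ∃ c : SignType, c ≠ 0 ∧ ∀ᶠ z in l, ∏ i ∈ s, u i z = c * ∏ i ∈ s, v i z := by
  choose! c hc hu using h
  refine ⟨∏ i ∈ s, c i, SignType.prod_ne_zero hc, ?_⟩
  filter_upwards [(Finset.eventually_all s).2 hu] with z hz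
  rw [← Finset.prod_mul_distrib]
  exact Finset.prod_congr rfl hz

theorem IsPreconnected.forall_pos_or_forall_neg {X : Type*} [TopologicalSpace X] {s : Set X}
    (hs : IsPreconnected s) {h : X → ℝ} (hc : ContinuousOn h s) (hne : ∀ x ∈ s, h x ≠ 0) :
    (∀ x ∈ s, 0 < h x) ∨ (∀ x ∈ s, h x < 0) := by
  by_contra! hcon
  obtain ⟨⟨x, hx, hx0⟩, y, hy, hy0⟩ := hcon
  obtain ⟨z, hz, hz0⟩ := hs.intermediate_value hx hy hc ⟨hx0, hy0⟩
  exact hne z hz hz0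

end SignLemmas

/-! ### Sign changes of a periodic function. -/

section Parity

/-- A periodic sign function on the line which has finitely many zeros in a period, and behaves like
`± sign (t - t₀) ^ k t₀` near each `t₀`, has an even total vanishing order in a period. -/
theorem even_sum_of_periodic_sign {g : ℝ → SignType} {k : ℝ → ℕ} (hg : Function.Periodic g 1)
    (hk : Function.Periodic k 1) {T : Finset ℝ} (hT : ∀ a ∈ T, a ∈ Ico (0 : ℝ) 1)
    (hkT : ∀ t ∈ Ico (0 : ℝ) 1, t ∉ T → k t = 0)
    (hloc : ∀ t₀, ∃ c : SignType, c ≠ 0 ∧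
      ∀ᶠ t in 𝓝[≠] t₀, g t = c * sign (t - t₀) ^ k t₀) :
    Even (∑ a ∈ T, k a) := by
  -- The sines change sign exactly at `a + ℤ`, which cancels the sign changes of `g`, and a shift by
  -- `1` negates each of them. So `H` has a constant nonzero punctured germ value, while a shift
  -- multiplies it by `-1` to the total order.
  set H : ℝ → SignType := fun t => g t * ∏ a ∈ T, sign (Real.sin (Real.pi * (t - a))) ^ k a
  have hH : ∀ t₀, ∃ c : SignType, c ≠ 0 ∧ ∀ᶠ t in 𝓝[≠] t₀, H t = c := by
    intro t₀
    have hfr : ∀ a ∈ T, a ≠ Int.fract t₀ → Real.sin (Real.pi * (t₀ - a)) ≠ 0 := by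
      intro a ha hne h0
      obtain ⟨n, hn⟩ := Real.sin_eq_zero_iff.1 h0
      have hn' : t₀ = a + n := by
        have := mul_left_cancel₀ Real.pi_ne_zero ((mul_comm _ _).trans hn)
        linarith
      apply hne
      rw [hn', Int.fract_add_intCast, Int.fract_eq_self.2 (hT a ha)]
    have hkfr : k (Int.fract t₀) = k t₀ := by
      have := hk.sub_int_mul_eq ⌊t₀⌋ (x := t₀)
      rwa [mul_one, Int.self_sub_floor] at this
    obtain ⟨c₁, hc₁, h₁⟩ := hloc t₀
    have hfac : ∀ a ∈ T, ∃ c : SignType, c ≠ 0 ∧ ∀ᶠ t in 𝓝[≠] t₀,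
        sign (Real.sin (Real.pi * (t - a))) ^ k a =
          c * (if a = Int.fract t₀ then sign (t - t₀) ^ k t₀ else 1) := by
      intro a ha
      have hd : HasDerivAt (fun t => Real.sin (Real.pi * (t - a)))
          (Real.cos (Real.pi * (t₀ - a)) * (Real.pi * 1)) t₀ :=
        (((hasDerivAt_id t₀).sub_const a).const_mul Real.pi).sin
      by_cases hat : a = Int.fract t₀
      · have h0 : Real.sin (Real.pi * (t₀ - a)) = 0 := by
          rw [hat, Int.self_sub_fract, mul_comm]
          exact Real.sin_int_mul_pi _
        have hcos : Real.cos (Real.pi * (t₀ - a)) ≠ 0 := by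
          intro hc
          have := Real.sin_sq_add_cos_sq (Real.pi * (t₀ - a))
          rw [h0, hc] at this
          norm_num at this
        have hne : Real.cos (Real.pi * (t₀ - a)) * (Real.pi * 1) ≠ 0 :=
          mul_ne_zero hcos (by simp [Real.pi_ne_zero])
        refine ⟨_, pow_ne_zero (k a) (sign_ne_zero.2 hne),
          (hd.eventually_sign_eq h0 hne).filter_mono nhdsWithin_le_nhds |>.mono fun t ht => ?_⟩
        rw [ht, if_pos hat, mul_pow, hat, hkfr]
      · refine ⟨_, pow_ne_zero (k a) (sign_ne_zero.2 (hfr a ha hat)),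
          (hd.continuousAt.eventually_sign_eq (hfr a ha hat)).filter_mono nhdsWithin_le_nhds
            |>.mono fun t ht => ?_⟩
        rw [ht, if_neg hat, mul_one]
    obtain ⟨c₂, hc₂, h₂⟩ := eventually_prod_eq_mul_prod hfac
    refine ⟨c₁ * c₂, mul_ne_zero hc₁ hc₂, ?_⟩
    filter_upwards [h₁, h₂, self_mem_nhdsWithin] with t ht₁ ht₂ htne
    have hprod : (∏ a ∈ T, if a = Int.fract t₀ then sign (t - t₀) ^ k t₀ else 1)
        = sign (t - t₀) ^ k t₀ := by
      rw [Finset.prod_ite_eq']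
      split_ifs with hmem
      · rfl
      · rw [← hkfr, hkT _ ⟨Int.fract_nonneg _, Int.fract_lt_one _⟩ hmem, pow_zero]
    have hsq : sign (t - t₀) ^ k t₀ * sign (t - t₀) ^ k t₀ = 1 :=
      SignType.mul_self_of_ne_zero (pow_ne_zero _ (sign_ne_zero.2 (sub_ne_zero.2 htne)))
    calc H t = c₁ * c₂ * (sign (t - t₀) ^ k t₀ * sign (t - t₀) ^ k t₀) := by
          simp only [H, ht₁, ht₂, hprod]
          ac_rfl
      _ = c₁ * c₂ := by rw [hsq, mul_one]
  -- `H` itself may vanish at isolated points; its punctured limit `c` never does, and it is `c`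
  -- that is locally constant.
  choose c hc hcH using hH
  have huniq : ∀ t₀ b, (∀ᶠ t in 𝓝[≠] t₀, H t = b) → c t₀ = b := fun t₀ b hb => by
    obtain ⟨t, h1, h2⟩ := ((hcH t₀).and hb).exists
    exact h1.symm.trans h2
  have hlc : IsLocallyConstant c := by
    rw [IsLocallyConstant.iff_eventually_eq]
    intro t₀
    have h1 := (eventually_eventually_nhdsWithin.2 (hcH t₀))
    have h2 : ∀ᶠ t in 𝓝[≠] t₀, c t = c t₀ := by
      filter_upwards [h1, self_mem_nhdsWithin] with t ht htne
      apply huniq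
      rw [IsOpen.nhdsWithin_eq isOpen_compl_singleton htne] at ht
      exact ht.filter_mono nhdsWithin_le_nhds
    rw [eventually_nhdsWithin_iff] at h2
    filter_upwards [h2] with t ht
    by_cases h : t = t₀
    · rw [h]
    · exact ht h
  have hshift : ∀ t, H (t + 1) = H t * (-1) ^ ∑ a ∈ T, k a := by
    intro t
    have hs : ∀ a, sign (Real.sin (Real.pi * (t + 1 - a))) =
        sign (Real.sin (Real.pi * (t - a))) * (-1) := by
      intro a
      rw [show Real.pi * (t + 1 - a) = Real.pi * (t - a) + Real.pi by ring, Real.sin_add_pi,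
        Left.sign_neg, mul_neg_one]
    simp only [H, hg t, hs, mul_pow, Finset.prod_mul_distrib, Finset.prod_pow_eq_pow_sum, mul_assoc]
  have h1 : c (0 + 1) = c 0 * (-1) ^ ∑ a ∈ T, k a := by
    apply huniq
    have hmap : Tendsto (fun t : ℝ => t - 1) (𝓝[≠] (0 + 1)) (𝓝[≠] 0) := by
      refine tendsto_nhdsWithin_iff.2 ⟨?_, ?_⟩
      · have : Tendsto (fun t : ℝ => t - 1) (𝓝 (0 + 1)) (𝓝 (0 + 1 - 1)) :=
          (continuous_id.sub continuous_const).tendsto _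
        rw [add_sub_cancel_right] at this
        exact this.mono_left nhdsWithin_le_nhds
      · filter_upwards [self_mem_nhdsWithin] with t ht h
        exact ht (by simp only [mem_singleton_iff] at h ⊢; linarith)
    filter_upwards [hmap.eventually (hcH 0)] with t ht
    rw [← ht, ← hshift, sub_add_cancel]
  rcases Nat.even_or_odd (∑ a ∈ T, k a) with he | ho
  · exact he
  · exfalso
    rw [hlc.apply_eq_of_isPreconnected isPreconnected_univ (mem_univ (0 + 1)) (mem_univ 0),
      ho.neg_one_pow] at h1
    have := hc 0
    revert h1 this
    generalize c 0 = b
    revert b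
    decide

end Parity

/-! ### Gluing sign germs over a ball. -/

section Gluing

variable {X : Type*} [TopologicalSpace X]

/-- Two sign functions agree up to a global sign near `q`. -/
def SignGermEq (s s' : X → SignType) (q : X) : Prop :=
  ∃ c : SignType, c ≠ 0 ∧ ∀ᶠ z in 𝓝 q, s z = c * s' z

theorem SignGermEq.symm {s s' : X → SignType} {q : X} (h : SignGermEq s s' q) :
    SignGermEq s' s q := by
  obtain ⟨c, hc, h⟩ := h
  refine ⟨c, hc, h.mono fun z hz => ?_⟩
  rw [hz, ← mul_assoc, SignType.mul_self_of_ne_zero hc, one_mul]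

theorem SignGermEq.trans {s s' s'' : X → SignType} {q : X} (h : SignGermEq s s' q)
    (h' : SignGermEq s' s'' q) : SignGermEq s s'' q := by
  obtain ⟨c, hc, h⟩ := h
  obtain ⟨c', hc', h'⟩ := h'
  refine ⟨c * c', mul_ne_zero hc hc', ?_⟩
  filter_upwards [h, h'] with z hz hz'
  rw [hz, hz', mul_assoc]

theorem SignGermEq.of_const_mul {s s' : X → SignType} {q : X} {c : SignType} (hc : c ≠ 0)
    (h : ∀ᶠ z in 𝓝 q, s z = c * s' z) : SignGermEq s s' q :=
  ⟨c, hc, h⟩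

theorem SignGermEq.frequently_ne_zero {s s' : X → SignType} {q : X} (h : SignGermEq s s' q)
    (h' : ∃ᶠ z in 𝓝 q, s' z ≠ 0) : ∃ᶠ z in 𝓝 q, s z ≠ 0 := by
  obtain ⟨c, hc, h⟩ := h
  refine (h'.and_eventually h).mono fun z hz => ?_
  rw [hz.2]
  exact mul_ne_zero hc hz.1

/-- The functions may vanish at `q` itself, so the factor is read off at nearby points. -/
theorem sign_factor_unique {s s' : X → SignType} {q : X} (h' : ∃ᶠ z in 𝓝 q, s' z ≠ 0)
    {c d : SignType} (hc : ∀ᶠ z in 𝓝 q, s z = c * s' z) (hd : ∀ᶠ z in 𝓝 q, s z = d * s' z) :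
    c = d := by
  obtain ⟨z, hz, h1, h2⟩ := (h'.and_eventually (hc.and hd)).exists
  exact SignType.mul_right_cancel_of_ne_zero hz (h1.symm.trans h2)

/-- The points with local factor `c` and those with local factor `-c` form two open sets covering
`U`, disjoint on `U` by uniqueness of the factor. -/
theorem IsPreconnected.exists_sign_factor {U : Set X} (hU : IsPreconnected U)
    {s s' : X → SignType} (hs : ∀ q ∈ U, SignGermEq s s' q)
    (hne : ∀ q ∈ U, ∃ᶠ z in 𝓝 q, s' z ≠ 0) :
    ∃ c : SignType, c ≠ 0 ∧ ∀ q ∈ U, ∀ᶠ z in 𝓝 q, s z = c * s' z := by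
  rcases U.eq_empty_or_nonempty with rfl | ⟨q₀, hq₀⟩
  · exact ⟨1, by decide, by simp⟩
  obtain ⟨c, hc, hc₀⟩ := hs q₀ hq₀
  refine ⟨c, hc, ?_⟩
  set A : Set X := {q | ∀ᶠ z in 𝓝 q, s z = c * s' z}
  set B : Set X := {q | ∀ᶠ z in 𝓝 q, s z = -c * s' z}
  have hA : IsOpen A := isOpen_setOfPred_eventually_nhds
  have hB : IsOpen B := isOpen_setOfPred_eventually_nhds
  have hcover : U ⊆ A ∪ B := by
    intro q hq
    obtain ⟨d, hd, hdq⟩ := hs q hq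
    have : d = c ∨ d = -c := SignType.eq_or_eq_neg_of_ne_zero hd hc
    rcases this with rfl | rfl
    · exact Or.inl hdq
    · exact Or.inr hdq
  have hdisj : U ∩ (A ∩ B) = ∅ := by
    rw [Set.eq_empty_iff_forall_notMem]
    rintro q ⟨hq, hqA, hqB⟩
    exact SignType.ne_neg_of_ne_zero hc (sign_factor_unique (hne q hq) hqA hqB)
  rcases (isPreconnected_iff_subset_of_disjoint.1 hU) A B hA hB hcover hdisj with h | h
  · exact h
  · exact absurd (show q₀ ∈ U ∩ (A ∩ B) from ⟨hq₀, hc₀, h hq₀⟩) (by simp [hdisj])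

/-- A locally consistent system of sign germs on a finite dimensional space is, up to signs, induced
by a single sign function on any given ball. -/
theorem exists_sign_function_on_ball {E : Type*} [NormedAddCommGroup E] [NormedSpace ℝ E]
    [ProperSpace E] {σ : E → E → SignType}
    (hσ : ∀ p, ∀ᶠ q in 𝓝 p, SignGermEq (σ p) (σ q) q)
    (hne : ∀ p, ∃ᶠ z in 𝓝 p, σ p z ≠ 0) (R : ℝ) :
    ∃ s : E → SignType, ∀ q ∈ Metric.ball (0 : E) R, SignGermEq s (σ q) q := by
  obtain ⟨δ, hδ, hleb⟩ := lebesgue_number_lemma_of_metric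
    (c := fun p => interior {q | SignGermEq (σ p) (σ q) q}) (isCompact_closedBall (0 : E) R)
    (fun _ => isOpen_interior)
    (fun p _ => mem_iUnion.2 ⟨p, mem_interior_iff_mem_nhds.2 (hσ p)⟩)
  have hloc : ∀ p ∈ Metric.closedBall (0 : E) R, ∃ u : E → SignType,
      ∀ q ∈ Metric.ball p δ, SignGermEq u (σ q) q := fun p hp => by
    obtain ⟨p', hp'⟩ := hleb p hp
    have hsub : Metric.ball p δ ⊆ {q | SignGermEq (σ p') (σ q) q} := hp'.trans interior_subset
    exact ⟨σ p', fun q hq => hsub hq⟩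
  choose! u hu using hloc
  -- Induction on the radius: each `δ`-ball centred in the ball of radius `r` carries a local
  -- solution, normalised by `ε` to agree with `s` on the overlap.
  have step : ∀ r, 0 < r → r ≤ R →
      (∃ s : E → SignType, ∀ q ∈ Metric.ball (0 : E) r, SignGermEq s (σ q) q) →
      ∃ s : E → SignType, ∀ q ∈ Metric.ball (0 : E) (r + δ), SignGermEq s (σ q) q := by
    rintro r hr hrR ⟨s, hs⟩
    have hmem : ∀ p ∈ Metric.ball (0 : E) r, p ∈ Metric.closedBall (0 : E) R := fun p hp =>
      Metric.closedBall_subset_closedBall hrR (Metric.ball_subset_closedBall hp)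
    have hune : ∀ p ∈ Metric.ball (0 : E) r, ∀ q ∈ Metric.ball p δ, ∃ᶠ z in 𝓝 q, u p z ≠ 0 :=
      fun p hp q hq => (hu p (hmem p hp) q hq).frequently_ne_zero (hne q)
    have hε : ∀ p ∈ Metric.ball (0 : E) r, ∃ c : SignType, c ≠ 0 ∧
        ∀ q ∈ Metric.ball p δ ∩ Metric.ball 0 r, ∀ᶠ z in 𝓝 q, s z = c * u p z := fun p hp =>
      ((convex_ball p δ).inter (convex_ball 0 r)).isPreconnected.exists_sign_factor
        (fun q hq => (hs q hq.2).trans (hu p (hmem p hp) q hq.1).symm)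
        (fun q hq => hune p hp q hq.1)
    choose! ε hε hεs using hε
    have hcons : ∀ p ∈ Metric.ball (0 : E) r, ∀ p' ∈ Metric.ball (0 : E) r,
        ∀ z ∈ Metric.ball p δ ∩ Metric.ball p' δ, ε p * u p z = ε p' * u p' z := by
      intro p hp p' hp' z hz
      have hgerm : ∀ q ∈ Metric.ball p δ ∩ Metric.ball p' δ,
          SignGermEq (fun z => ε p * u p z) (fun z => ε p' * u p' z) q := fun q hq =>
        (SignGermEq.of_const_mul (hε p hp) (Eventually.of_forall fun _ => rfl)).trans
          (((hu p (hmem p hp) q hq.1).trans (hu p' (hmem p' hp') q hq.2).symm).trans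
            (SignGermEq.of_const_mul (hε p' hp') (Eventually.of_forall fun _ => rfl)).symm)
      have hnz : ∀ q ∈ Metric.ball p δ ∩ Metric.ball p' δ,
          ∃ᶠ z in 𝓝 q, ε p' * u p' z ≠ 0 := fun q hq =>
        (hune p' hp' q hq.2).mono fun z hz => mul_ne_zero (hε p' hp') hz
      obtain ⟨c, hc, hcq⟩ := ((convex_ball p δ).inter
        (convex_ball p' δ)).isPreconnected.exists_sign_factor hgerm hnz
      have hpp' : dist p p' < 2 * δ := by
        have h1 := hz.1
        have h2 := hz.2
        rw [Metric.mem_ball] at h1 h2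
        linarith [dist_triangle_left p p' z]
      -- The overlap of two `δ`-balls is convex, so one factor relates the two solutions on it. The
      -- midpoint of the centres lies in the overlap and in the `r`-ball, where both agree with `s`;
      -- the factor is therefore `1`.
      have hm : midpoint ℝ p p' ∈ Metric.ball p δ ∩ Metric.ball p' δ := by
        simp only [mem_inter_iff, Metric.mem_ball, dist_midpoint_left, dist_midpoint_right]
        norm_num
        linarith
      have hm0 : midpoint ℝ p p' ∈ Metric.ball (0 : E) r :=
        (convex_ball (0 : E) r).midpoint_mem hp hp'
      have hc1 : c = 1 := by
        refine sign_factor_unique (hnz _ hm) (hcq _ hm) ?_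
        filter_upwards [hεs p hp _ ⟨hm.1, hm0⟩, hεs p' hp' _ ⟨hm.2, hm0⟩] with w h1 h2
        rw [← h1, ← h2, one_mul]
      simpa [hc1] using (hcq z hz).self_of_nhds
    have hnear : ∀ z ∈ Metric.ball (0 : E) (r + δ), ∃ p ∈ Metric.ball (0 : E) r,
        z ∈ Metric.ball p δ := by
      intro z hz
      rw [mem_ball_zero_iff] at hz
      have hpos : 0 < r + δ := by linarith
      -- Radial contraction brings `z` into the `r`-ball and moves it by less than `δ`.
      refine ⟨(r / (r + δ)) • z, ?_, ?_⟩
      · rw [mem_ball_zero_iff, norm_smul, Real.norm_of_nonneg (by positivity), div_mul_eq_mul_div,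
          div_lt_iff₀ hpos]
        gcongr
      · have : z - (r / (r + δ)) • z = (δ / (r + δ)) • z := by
          rw [← one_smul ℝ z, smul_smul, ← sub_smul, one_smul]
          congr 1
          field_simp
          ring
        rw [Metric.mem_ball, dist_eq_norm, this, norm_smul, Real.norm_of_nonneg (by positivity),
          div_mul_eq_mul_div, div_lt_iff₀ hpos]
        gcongr
    choose! π hπ hzπ using hnear
    refine ⟨fun z => ε (π z) * u (π z) z, fun q hq => ?_⟩
    have hev : ∀ᶠ z in 𝓝 q, ε (π z) * u (π z) z = ε (π q) * u (π q) z := by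
      filter_upwards [Metric.isOpen_ball.mem_nhds hq, Metric.isOpen_ball.mem_nhds (hzπ q hq)]
        with z hz hzq
      exact hcons _ (hπ z hz) _ (hπ q hq) z ⟨hzπ z hz, hzq⟩
    exact (SignGermEq.of_const_mul (hε _ (hπ q hq)) hev).trans
      (hu _ (hmem _ (hπ q hq)) q (hzπ q hq))
  have hall : ∀ n : ℕ, ∃ s : E → SignType,
      ∀ q ∈ Metric.ball (0 : E) (min R ((n + 1) * δ)), SignGermEq s (σ q) q := by
    intro n
    induction n with
    | zero =>
      rcases lt_or_ge R 0 with hR | hR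
      · refine ⟨0, fun q hq => ?_⟩
        rw [mem_ball_zero_iff] at hq
        linarith [norm_nonneg q, min_le_left R (((0 : ℕ) + 1 : ℝ) * δ)]
      · refine ⟨u 0, fun q hq => hu 0 (by simpa using hR) q (Metric.ball_subset_ball ?_ hq)⟩
        refine (min_le_right _ _).trans ?_
        simp
    | succ n ih =>
      by_cases h : R ≤ (n + 1) * δ
      · rw [min_eq_left h] at ih
        exact ih.imp fun s hs q hq => hs q (Metric.ball_subset_ball (min_le_left _ _) hq)
      · push Not at h
        rw [min_eq_right h.le] at ih
        refine (step _ (by positivity) h.le ih).imp fun s hs q hq =>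
          hs q (Metric.ball_subset_ball ((min_le_right _ _).trans ?_) hq)
        push_cast
        linarith
  obtain ⟨n, hn⟩ := exists_nat_gt (R / δ)
  have hR : R ≤ (n + 1) * δ := by
    rw [div_lt_iff₀ hδ] at hn
    linarith
  have := hall n
  rwa [min_eq_left hR] at this

end Gluing

/-! ### Topological defining functions of a sheet. -/

section DefiningFunction

variable {S E : Type*} [TopologicalSpace S] [TopologicalSpace E]

/-- `φ` is a topological defining function, near `f y`, of the sheet of `f` through `y`: it vanishes
there exactly on the image of arbitrarily small neighbourhoods of `y`, and it separates two
locally connected sides. -/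
structure IsDefiningAt (f : S → E) (φ : E → ℝ) (y : S) : Prop where
  continuousAt : ∀ᶠ z in 𝓝 (f y), ContinuousAt φ z
  map_eq_zero : ∀ᶠ y' in 𝓝 y, φ (f y') = 0
  mem_image : ∀ N ∈ 𝓝 y, ∀ᶠ z in 𝓝 (f y), φ z = 0 → z ∈ f '' N
  sides : ∀ W ∈ 𝓝 (f y), ∃ W' ∈ 𝓝 (f y), W' ⊆ W ∧
    IsPreconnected (W' ∩ {z | 0 < φ z}) ∧ IsPreconnected (W' ∩ {z | φ z < 0})
  frequently_pos : ∃ᶠ z in 𝓝 (f y), 0 < φ z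
  frequently_neg : ∃ᶠ z in 𝓝 (f y), φ z < 0

theorem IsDefiningAt.eventually_eq_zero_imp {f : S → E} {φ ψ : E → ℝ} {y : S}
    (hφ : IsDefiningAt f φ y) (hψ : IsDefiningAt f ψ y) :
    ∀ᶠ z in 𝓝 (f y), φ z = 0 → ψ z = 0 := by
  filter_upwards [hφ.mem_image _ hψ.map_eq_zero] with z hz h0
  obtain ⟨y', hy', rfl⟩ := hz h0
  exact hy'

/-- Near `f y` both functions have the same zeros, so `ψ` has constant sign on each of the two
connected sides of `φ`. These signs are opposite because `ψ` takes both signs arbitrarily close to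
`f y`. -/
theorem IsDefiningAt.signGermEq {f : S → E} {φ ψ : E → ℝ} {y : S}
    (hφ : IsDefiningAt f φ y) (hψ : IsDefiningAt f ψ y) :
    SignGermEq (fun z => sign (ψ z)) (fun z => sign (φ z)) (f y) := by
  obtain ⟨W, hW, hWW, hpos, hneg⟩ := hφ.sides _ ((hφ.eventually_eq_zero_imp hψ).and
    ((hψ.eventually_eq_zero_imp hφ).and hψ.continuousAt))
  have hc : ∀ z ∈ W, ContinuousAt ψ z := fun z hz => (hWW hz).2.2
  have h1 := hpos.forall_pos_or_forall_neg (fun z hz => (hc z hz.1).continuousWithinAt)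
    (fun z hz h0 => (ne_of_gt hz.2) ((hWW hz.1).2.1 h0))
  have h2 := hneg.forall_pos_or_forall_neg (fun z hz => (hc z hz.1).continuousWithinAt)
    (fun z hz h0 => (ne_of_lt hz.2) ((hWW hz.1).2.1 h0))
  obtain ⟨a, ha, haW⟩ := (hψ.frequently_pos.and_eventually hW).exists
  obtain ⟨b, hb, hbW⟩ := (hψ.frequently_neg.and_eventually hW).exists
  have ha0 : φ a ≠ 0 := fun h => (ne_of_gt ha) ((hWW haW).1 h)
  have hb0 : φ b ≠ 0 := fun h => (ne_of_lt hb) ((hWW hbW).1 h)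
  rcases h1 with h1 | h1 <;> rcases h2 with h2 | h2
  · exfalso
    rcases lt_or_gt_of_ne hb0 with h | h
    · exact lt_asymm hb (h2 b ⟨hbW, h⟩)
    · exact lt_asymm hb (h1 b ⟨hbW, h⟩)
  · refine ⟨1, by decide, ?_⟩
    filter_upwards [hW] with z hz
    rcases lt_trichotomy (φ z) 0 with h | h | h
    · simp [sign_neg h, sign_neg (h2 z ⟨hz, h⟩)]
    · simp [h, (hWW hz).1 h]
    · simp [sign_pos h, sign_pos (h1 z ⟨hz, h⟩)]
  · refine ⟨-1, by decide, ?_⟩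
    filter_upwards [hW] with z hz
    rcases lt_trichotomy (φ z) 0 with h | h | h
    · simp [sign_neg h, sign_pos (h2 z ⟨hz, h⟩)]
    · simp [h, (hWW hz).1 h]
    · simp [sign_pos h, sign_neg (h1 z ⟨hz, h⟩)]
  · exfalso
    rcases lt_or_gt_of_ne ha0 with h | h
    · exact lt_asymm ha (h2 a ⟨haW, h⟩)
    · exact lt_asymm ha (h1 a ⟨haW, h⟩)

/-- In straightened coordinates the sheet is a piece of `V × {0}`, and the sides of a small ball are
convex half-balls. One function serves all points of the sheet. -/
theorem isDefiningAt_of_straightening {V : Type*} [NormedAddCommGroup V] [NormedSpace ℝ V]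
    {f : S → E} (a : OpenPartialHomeomorph S V) (Ψ : OpenPartialHomeomorph E (V × ℝ))
    (hmaps : MapsTo f a.source Ψ.source) (hΨ : ∀ y ∈ a.source, Ψ (f y) = (a y, 0))
    {y : S} (hy : y ∈ a.source) : IsDefiningAt f (fun z => (Ψ z).2) y := by
  have hfy := hmaps hy
  have hΨc : ∀ z ∈ Ψ.source, ContinuousAt (fun z => (Ψ z).2) z := fun z hz =>
    continuous_snd.continuousAt.comp (Ψ.continuousAt hz)
  have hsymm : Tendsto (fun c : ℝ => Ψ.symm (a y, c)) (𝓝 0) (𝓝 (f y)) := by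
    have h1 : ContinuousAt Ψ.symm (a y, (0 : ℝ)) := by
      rw [← hΨ y hy]
      exact Ψ.continuousAt_symm (Ψ.map_source hfy)
    have h2 : Tendsto (fun c : ℝ => (a y, c)) (𝓝 0) (𝓝 (a y, (0 : ℝ))) :=
      (Continuous.prodMk_right (a y)).tendsto 0
    have h3 : Ψ.symm (a y, 0) = f y := by rw [← hΨ y hy, Ψ.left_inv hfy]
    have := h1.tendsto.comp h2
    rwa [h3] at this
  have htarget : ∀ᶠ c : ℝ in 𝓝 0, (Ψ (Ψ.symm (a y, c))).2 = c := by
    have h2 : Tendsto (fun c : ℝ => (a y, c)) (𝓝 0) (𝓝 (a y, (0 : ℝ))) :=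
      (Continuous.prodMk_right (a y)).tendsto 0
    have h4 : (a y, (0 : ℝ)) ∈ Ψ.target := hΨ y hy ▸ Ψ.map_source hfy
    filter_upwards [h2.eventually (Ψ.open_target.mem_nhds h4)] with c hc
    rw [Ψ.right_inv hc]
  refine ⟨?_, ?_, ?_, ?_, ?_, ?_⟩
  · filter_upwards [Ψ.open_source.mem_nhds hfy] with z hz using hΨc z hz
  · filter_upwards [a.open_source.mem_nhds hy] with y' hy'
    rw [hΨ y' hy']
  · intro N hN
    have h1 : Tendsto (fun z => (Ψ z).1) (𝓝 (f y)) (𝓝 (a y)) := by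
      have := (continuous_fst.continuousAt.comp (Ψ.continuousAt hfy)).tendsto
      rwa [Function.comp_apply, hΨ y hy] at this
    have h2 : Tendsto a.symm (𝓝 (a y)) (𝓝 y) := by
      have := (a.continuousAt_symm (a.map_source hy)).tendsto
      rwa [a.left_inv hy] at this
    filter_upwards [Ψ.open_source.mem_nhds hfy, (h2.comp h1).eventually hN,
      h1.eventually (a.open_target.mem_nhds (a.map_source hy))] with z hz hzN hzt hz0
    refine ⟨_, hzN, Ψ.injOn (hmaps (a.map_target hzt)) hz ?_⟩
    rw [hΨ _ (a.map_target hzt), a.right_inv hzt]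
    exact Prod.ext rfl hz0.symm
  · intro W hW
    have h1 : Ψ.symm ⁻¹' W ∩ Ψ.target ∈ 𝓝 (Ψ (f y)) := by
      refine inter_mem ?_ (Ψ.open_target.mem_nhds (Ψ.map_source hfy))
      refine (Ψ.continuousAt_symm (Ψ.map_source hfy)).preimage_mem_nhds ?_
      rwa [Ψ.left_inv hfy]
    obtain ⟨r, hr, hrW⟩ := Metric.mem_nhds_iff.1 h1
    set B := Metric.ball (Ψ (f y)) r
    have himg : ∀ P : Set (V × ℝ), (Ψ.source ∩ Ψ ⁻¹' B) ∩ {z | Ψ z ∈ P} = Ψ.symm '' (B ∩ P) := by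
      intro P
      ext z
      constructor
      · rintro ⟨⟨hz, hzB⟩, hzP⟩
        exact ⟨Ψ z, ⟨hzB, hzP⟩, Ψ.left_inv hz⟩
      · rintro ⟨w, ⟨hwB, hwP⟩, rfl⟩
        have hw := (hrW hwB).2
        refine ⟨⟨Ψ.map_target hw, ?_⟩, ?_⟩
        · rwa [mem_preimage, Ψ.right_inv hw]
        · rwa [mem_ofPred_eq, Ψ.right_inv hw]
    have hconn : ∀ P : Set (V × ℝ), Convex ℝ P →
        IsPreconnected ((Ψ.source ∩ Ψ ⁻¹' B) ∩ {z | Ψ z ∈ P}) := by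
      intro P hP
      rw [himg]
      exact ((convex_ball _ _).inter hP).isPreconnected.image _
        (Ψ.continuousOn_symm.mono fun w hw => (hrW hw.1).2)
    refine ⟨Ψ.source ∩ Ψ ⁻¹' B, ?_, ?_, ?_, ?_⟩
    · exact inter_mem (Ψ.open_source.mem_nhds hfy)
        ((Ψ.continuousAt hfy).preimage_mem_nhds (Metric.ball_mem_nhds _ hr))
    · rintro z ⟨hz, hzB⟩
      have := (hrW hzB).1
      rwa [mem_preimage, Ψ.left_inv hz] at this
    · exact hconn {w | 0 < w.2} (convex_halfSpace_gt (LinearMap.snd ℝ V ℝ).isLinear 0)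
    · exact hconn {w | w.2 < 0} (convex_halfSpace_lt (LinearMap.snd ℝ V ℝ).isLinear 0)
  · refine hsymm.frequently ?_
    have h : ∃ᶠ c : ℝ in 𝓝 0, 0 < c :=
      (Filter.Eventually.frequently (f := 𝓝[>] (0 : ℝ)) self_mem_nhdsWithin).filter_mono
        nhdsWithin_le_nhds
    exact (h.and_eventually htarget).mono fun c hc => by rw [hc.2]; exact hc.1
  · refine hsymm.frequently ?_
    have h : ∃ᶠ c : ℝ in 𝓝 0, c < 0 :=
      (Filter.Eventually.frequently (f := 𝓝[<] (0 : ℝ)) self_mem_nhdsWithin).filter_mono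
        nhdsWithin_le_nhds
    exact (h.and_eventually htarget).mono fun c hc => by rw [hc.2]; exact hc.1

end DefiningFunction

/-! ### Straightening an immersed surface. -/

section Immersion

variable {S : Type*} [TopologicalSpace S] [ChartedSpace (EuclideanSpace ℝ (Fin 2)) S]

theorem Manifold.IsImmersionAt.exists_straightening {f : S → EuclideanSpace ℝ (Fin 3)} {x : S}
    (h : IsImmersionAt (𝓡 2) 𝓘(ℝ, EuclideanSpace ℝ (Fin 3)) ∞ f x) :
    ∃ (a : OpenPartialHomeomorph S (EuclideanSpace ℝ (Fin 2)))
      (Ψ : OpenPartialHomeomorph (EuclideanSpace ℝ (Fin 3)) (EuclideanSpace ℝ (Fin 2) × ℝ)),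
      x ∈ a.source ∧ MapsTo f a.source Ψ.source ∧ (∀ y ∈ a.source, Ψ (f y) = (a y, 0)) ∧
      DifferentiableAt ℝ Ψ (f x) ∧ DifferentiableAt ℝ Ψ.symm (Ψ (f x)) := by
  have L := h.equiv
  have hfin : FiniteDimensional ℝ h.complement :=
    FiniteDimensional.of_injective
      (L.toLinearEquiv.toLinearMap ∘ₗ LinearMap.inr ℝ (EuclideanSpace ℝ (Fin 2)) h.complement)
      (L.injective.comp (Prod.mk_right_injective 0))
  have hrank : Module.finrank ℝ h.complement = Module.finrank ℝ ℝ := by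
    have := L.toLinearEquiv.finrank_eq
    rw [Module.finrank_prod, finrank_euclideanSpace_fin, finrank_euclideanSpace_fin] at this
    rw [Module.finrank_self]
    omega
  let ℓ : h.complement ≃L[ℝ] ℝ := ContinuousLinearEquiv.ofFinrankEq hrank
  let M : EuclideanSpace ℝ (Fin 3) ≃L[ℝ] (EuclideanSpace ℝ (Fin 2) × ℝ) :=
    h.equiv.symm.trans ((ContinuousLinearEquiv.refl ℝ _).prodCongr ℓ)
  have hsmooth : DifferentiableAt ℝ h.codChart (f x) := by
    have := (contMDiffOn_of_mem_maximalAtlas h.codChart_mem_maximalAtlas).contMDiffAt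
      (h.codChart.open_source.mem_nhds h.mem_codChart_source)
    exact this.contDiffAt.differentiableAt (by simp)
  have hsmooth' : DifferentiableAt ℝ h.codChart.symm (h.codChart (f x)) := by
    have := (contMDiffOn_symm_of_mem_maximalAtlas h.codChart_mem_maximalAtlas).contMDiffAt
      (h.codChart.open_target.mem_nhds (h.codChart.map_source h.mem_codChart_source))
    exact this.contDiffAt.differentiableAt (by simp)
  refine ⟨h.domChart, h.codChart.transHomeomorph M.toHomeomorph, h.mem_domChart_source,
    h.source_subset_preimage_source, ?_, ?_, ?_⟩
  · intro y hy
    have hmem : h.domChart y ∈ (h.domChart.extend (𝓡 2)).target := by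
      simpa using h.domChart.map_source hy
    have hw := h.writtenInCharts hmem
    simp [h.domChart.left_inv hy] at hw
    simp [hw, M]
  · exact M.differentiableAt.comp (f x) hsmooth
  · have h1 : (h.codChart.transHomeomorph M.toHomeomorph).symm = h.codChart.symm ∘ M.symm := rfl
    rw [h1]
    refine DifferentiableAt.comp _ ?_ M.symm.differentiableAt
    have h2 : M.symm ((h.codChart.transHomeomorph M.toHomeomorph) (f x)) = h.codChart (f x) :=
      M.symm_apply_apply _
    rwa [h2]

/-- An immersed surface has, near each of its points `x`, a defining function which is
differentiable at `f x` with nonzero derivative vanishing on the tangent plane. -/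
theorem Manifold.IsImmersionAt.exists_isDefiningAt {f : S → EuclideanSpace ℝ (Fin 3)} {x : S}
    (h : IsImmersionAt (𝓡 2) 𝓘(ℝ, EuclideanSpace ℝ (Fin 3)) ∞ f x) :
    ∃ (φ : EuclideanSpace ℝ (Fin 3) → ℝ) (U : Set S)
      (D : EuclideanSpace ℝ (Fin 3) →L[ℝ] ℝ), IsOpen U ∧ x ∈ U ∧ InjOn f U ∧
      (∀ y ∈ U, IsDefiningAt f φ y) ∧ HasFDerivAt φ D (f x) ∧ D ≠ 0 ∧
      ∀ v, D ((mfderiv (𝓡 2) 𝓘(ℝ, EuclideanSpace ℝ (Fin 3)) f x :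
        EuclideanSpace ℝ (Fin 2) →L[ℝ] EuclideanSpace ℝ (Fin 3)) v) = 0 := by
  obtain ⟨a, Ψ, hx, hmaps, hΨ, hd, hd'⟩ := h.exists_straightening
  have hφ : DifferentiableAt ℝ (fun z => (Ψ z).2) (f x) := hd.snd
  refine ⟨fun z => (Ψ z).2, a.source, fderiv ℝ (fun z => (Ψ z).2) (f x), a.open_source, hx, ?_,
    fun y hy => isDefiningAt_of_straightening a Ψ hmaps hΨ hy, hφ.hasFDerivAt, ?_, ?_⟩
  · intro y hy y' hy' hyy'
    have h1 := hΨ y hy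
    rw [hyy', hΨ y' hy'] at h1
    exact a.injOn hy hy' (Prod.mk.inj h1).1.symm
  -- Composed with `Ψ.symm`, the function becomes the second coordinate, whose derivative is not
  -- zero.
  · intro h0
    have hfx := hmaps hx
    have h1 : HasFDerivAt ((fun z => (Ψ z).2) ∘ Ψ.symm) _ (Ψ (f x)) :=
      HasFDerivAt.comp (Ψ (f x)) (by rw [Ψ.left_inv hfx]; exact hφ.hasFDerivAt) hd'.hasFDerivAt
    rw [h0, ContinuousLinearMap.zero_comp] at h1
    have h2 : (fun w : EuclideanSpace ℝ (Fin 2) × ℝ => w.2) =ᶠ[𝓝 (Ψ (f x))]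
        (fun z => (Ψ z).2) ∘ Ψ.symm := by
      filter_upwards [Ψ.open_target.mem_nhds (Ψ.map_source hfx)] with w hw
      simp [Ψ.right_inv hw]
    have h3 := (h1.congr_of_eventuallyEq h2).unique hasFDerivAt_snd
    have h4 := DFunLike.congr_fun h3 ((0 : EuclideanSpace ℝ (Fin 2)), (1 : ℝ))
    simp at h4
  · intro v
    have hfd : MDifferentiableAt (𝓡 2) 𝓘(ℝ, EuclideanSpace ℝ (Fin 3)) f x :=
      h.contMDiffAt.mdifferentiableAt (by simp)
    have h1 := hφ.hasFDerivAt.hasMFDerivAt.comp x hfd.hasMFDerivAt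
    have h2 : (fun z => (Ψ z).2) ∘ f =ᶠ[𝓝 x] fun _ => (0 : ℝ) := by
      filter_upwards [a.open_source.mem_nhds hx] with y hy
      simp [hΨ y hy]
    have h3 := hasMFDerivAt_unique (h1.congr_of_eventuallyEq h2.symm)
      (hasMFDerivAt_const (0 : ℝ) x)
    exact DFunLike.congr_fun h3 v

end Immersion

/-! ### Products of signs over the fibres. -/

section Fibers

theorem IsCompact.finite_of_subsingleton_inter {X : Type*} [TopologicalSpace X] {K : Set X}
    (hK : IsCompact K) (h : ∀ x ∈ K, ∃ N ∈ 𝓝 x, (K ∩ N).Subsingleton) : K.Finite := by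
  choose! N hN hsub using h
  obtain ⟨t, ht, hcov⟩ := hK.elim_nhds_subcover N hN
  refine (t.finite_toSet.biUnion fun x hx => (hsub x (ht x hx)).finite).subset
    fun y hy => ?_
  obtain ⟨x, hx, hyx⟩ := mem_iUnion₂.1 (hcov hy)
  exact mem_iUnion₂.2 ⟨x, hx, hy, hyx⟩

theorem Continuous.finite_fiber_of_locally_injOn {S E : Type*} [TopologicalSpace S] [CompactSpace S]
    [TopologicalSpace E] [T1Space E] {f : S → E} (hf : Continuous f)
    (h : ∀ x, ∃ N ∈ 𝓝 x, InjOn f N) (p : E) : (f ⁻¹' {p}).Finite := by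
  refine (isClosed_singleton.preimage hf).isCompact.finite_of_subsingleton_inter fun x _ => ?_
  obtain ⟨N, hN, hinj⟩ := h x
  refine ⟨N, hN, fun y hy z hz => hinj hy.2 hz.2 ?_⟩
  exact (show f y = p from hy.1).trans (show f z = p from hz.1).symm

/-- The product of the signs of the functions `φ x` over the finite fibre of `f` above `p`. -/
noncomputable def fiberSign {S E : Type*} {f : S → E} (hfin : ∀ p, (f ⁻¹' {p}).Finite)
    (φ : S → E → ℝ) (p z : E) : SignType :=
  ∏ x ∈ (hfin p).toFinset, sign (φ x z)

/-- For `q` near `p`, each point above `q` lies in exactly one of the disjoint neighbourhoods `V x`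
of the points `x` above `p`, and each `V x` contains at most one. If it contains `y`, then `φ x` and
`φ y` define the same sheet there; if none, `φ x` is nonzero at `q` and contributes a constant sign.
-/
theorem fiberSign_signGermEq {S E : Type*} [TopologicalSpace S] [CompactSpace S] [T2Space S]
    [TopologicalSpace E] [T2Space E] {f : S → E} (hf : Continuous f)
    (hfin : ∀ p, (f ⁻¹' {p}).Finite) {φ : S → E → ℝ} {U : S → Set S} (hU : ∀ x, IsOpen (U x))
    (hxU : ∀ x, x ∈ U x) (hinj : ∀ x, InjOn f (U x))
    (hdef : ∀ x, ∀ y ∈ U x, IsDefiningAt f (φ x) y) (p : E) :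
    ∀ᶠ q in 𝓝 p, SignGermEq (fiberSign hfin φ p) (fiberSign hfin φ q) q := by
  classical
  obtain ⟨W, hW, hdisj⟩ := (hfin p).t2_separation
  set F := (hfin p).toFinset
  have hF : ∀ x, x ∈ F ↔ f x = p := fun x => by simp [F]
  set V : S → Set S := fun x => U x ∩ W x
  have hVo : ∀ x, IsOpen (V x) := fun x => (hU x).inter (hW x).2
  have hVx : ∀ x, x ∈ V x := fun x => ⟨hxU x, (hW x).1⟩
  have hcov : ∀ᶠ q in 𝓝 p, ∀ y, f y = q → ∃ x ∈ F, y ∈ V x := by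
    -- Compactness of `S` makes `f` closed, so no point above a nearby `q` can escape the chosen
    -- neighbourhoods.
    have hcl : IsClosed (f '' (⋃ x ∈ F, V x)ᶜ) :=
      hf.isClosedMap _ (isOpen_biUnion fun x _ => hVo x).isClosed_compl
    have hp : p ∈ (f '' (⋃ x ∈ F, V x)ᶜ)ᶜ := by
      rintro ⟨y, hy, hyp⟩
      exact hy (mem_iUnion₂.2 ⟨y, (hF y).2 hyp, hVx y⟩)
    filter_upwards [hcl.isOpen_compl.mem_nhds hp] with q hq y hy
    by_contra hcon
    exact hq ⟨y, fun hy' => hcon (by simpa using hy'), hy⟩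
  have hzero : ∀ᶠ q in 𝓝 p, ∀ x ∈ F,
      (φ x q = 0 → q ∈ f '' V x) ∧ ContinuousAt (φ x) q := by
    refine (Finset.eventually_all F).2 fun x hx => ?_
    have hd := hdef x x (hxU x)
    rw [← (hF x).1 hx]
    exact (hd.mem_image _ ((hVo x).mem_nhds (hVx x))).and hd.continuousAt
  filter_upwards [hcov, hzero] with q hq hz
  set G := (hfin q).toFinset
  have hG : ∀ y, y ∈ G ↔ f y = q := fun y => by simp [G]
  have hsplit : ∀ z, fiberSign hfin φ q z =
      ∏ x ∈ F, ∏ y ∈ G with y ∈ V x, sign (φ y z) := by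
    intro z
    rw [← Finset.prod_biUnion]
    · refine Finset.prod_congr ?_ fun _ _ => rfl
      ext y
      simp only [Finset.mem_biUnion, Finset.mem_filter]
      constructor
      · intro hy
        obtain ⟨x, hx, hyx⟩ := hq y ((hG y).1 hy)
        exact ⟨x, hx, hy, hyx⟩
      · rintro ⟨x, -, hy, -⟩
        exact hy
    · intro x hx x' hx' hne
      rw [Function.onFun, Finset.disjoint_left]
      intro y hy hy'
      rw [Finset.mem_filter] at hy hy'
      exact Set.disjoint_left.1 (hdisj ((hF x).1 hx) ((hF x').1 hx') hne) hy.2.2 hy'.2.2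
  have hfac : ∀ x ∈ F, ∃ c : SignType, c ≠ 0 ∧ ∀ᶠ z in 𝓝 q,
      sign (φ x z) = c * ∏ y ∈ G with y ∈ V x, sign (φ y z) := by
    intro x hx
    by_cases h0 : φ x q = 0
    · obtain ⟨y, hyV, hyq⟩ := (hz x hx).1 h0
      have hsing : G.filter (· ∈ V x) = {y} := by
        ext y'
        rw [Finset.mem_filter, Finset.mem_singleton, hG]
        constructor
        · rintro ⟨h1, h2⟩
          exact hinj x h2.1 hyV.1 (h1.trans hyq.symm)
        · rintro rfl
          exact ⟨hyq, hyV⟩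
      simp only [hsing, Finset.prod_singleton]
      rw [← hyq]
      exact (hdef y y (hxU y)).signGermEq (hdef x y hyV.1)
    · have hempty : G.filter (· ∈ V x) = ∅ := by
        rw [Finset.filter_eq_empty_iff]
        intro y hy hyV
        apply h0
        rw [← (hG y).1 hy]
        exact (hdef x y hyV.1).map_eq_zero.self_of_nhds
      simp only [hempty, Finset.prod_empty, mul_one]
      exact ⟨_, sign_ne_zero.2 h0, (hz x hx).2.eventually_sign_eq h0⟩
  obtain ⟨c, hc, h⟩ := eventually_prod_eq_mul_prod hfac
  refine ⟨c, hc, h.mono fun z hz => ?_⟩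
  rw [hsplit]
  exact hz

theorem fiberSign_comp_curve {S E : Type*} [NormedAddCommGroup E] [NormedSpace ℝ E] {f : S → E}
    (hfin : ∀ p, (f ⁻¹' {p}).Finite) {φ : S → E → ℝ} {D : S → E →L[ℝ] ℝ}
    (hφ : ∀ x, φ x (f x) = 0) (hD : ∀ x, HasFDerivAt (φ x) (D x) (f x))
    {γ : ℝ → E} {γ' : E} {t₀ : ℝ} (hγ : HasDerivAt γ γ' t₀)
    (hne : ∀ x, f x = γ t₀ → D x γ' ≠ 0) :
    ∃ c : SignType, c ≠ 0 ∧ ∀ᶠ t in 𝓝 t₀, fiberSign hfin φ (γ t₀) (γ t) =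
      c * sign (t - t₀) ^ (hfin (γ t₀)).toFinset.card := by
  have hfac : ∀ x ∈ (hfin (γ t₀)).toFinset, ∃ c : SignType, c ≠ 0 ∧ ∀ᶠ t in 𝓝 t₀,
      sign (φ x (γ t)) = c * sign (t - t₀) := by
    intro x hx
    have hfx : f x = γ t₀ := by simpa using hx
    have hd : HasDerivAt (fun t => φ x (γ t)) (D x γ') t₀ :=
      HasFDerivAt.comp_hasDerivAt t₀ (hfx ▸ hD x) hγ
    exact ⟨_, sign_ne_zero.2 (hne x hfx),
      hd.eventually_sign_eq (by rw [← hfx, hφ x]) (hne x hfx)⟩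
  obtain ⟨c, hc, h⟩ := eventually_prod_eq_mul_prod hfac
  refine ⟨c, hc, h.mono fun t ht => ?_⟩
  rw [fiberSign, ht, Finset.prod_const]

theorem fiberSign_frequently_ne_zero {S E : Type*} [NormedAddCommGroup E] [NormedSpace ℝ E]
    {f : S → E} (hfin : ∀ p, (f ⁻¹' {p}).Finite) {φ : S → E → ℝ} {D : S → E →L[ℝ] ℝ}
    (hφ : ∀ x, φ x (f x) = 0) (hD : ∀ x, HasFDerivAt (φ x) (D x) (f x)) (hD0 : ∀ x, D x ≠ 0)
    (p : E) : ∃ᶠ z in 𝓝 p, fiberSign hfin φ p z ≠ 0 := by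
  have := (hfin p).to_subtype
  -- Finitely many hyperplanes do not fill the space; the line through `p` along `v` crosses every
  -- sheet transversally.
  obtain ⟨v, hv⟩ := Module.Dual.exists_forall_ne_zero_of_forall_exists
    (fun x : f ⁻¹' {p} => (D x : E →ₗ[ℝ] ℝ)) fun x => by
      by_contra! hcon
      exact hD0 x (ContinuousLinearMap.ext hcon)
  have hγ : HasDerivAt (fun t : ℝ => p + t • v) v 0 := by
    simpa using ((hasDerivAt_id (0 : ℝ)).smul_const v).const_add p
  obtain ⟨c, hc, h⟩ := fiberSign_comp_curve hfin hφ hD hγ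
    (fun x hx => hv ⟨x, by simpa using hx⟩)
  simp only [zero_smul, add_zero, sub_zero] at h
  have ht : Tendsto (fun t : ℝ => p + t • v) (𝓝[≠] 0) (𝓝 p) := by
    have := hγ.continuousAt.tendsto
    simp only [zero_smul, add_zero] at this
    exact this.mono_left nhdsWithin_le_nhds
  refine ht.frequently (Eventually.frequently ?_)
  filter_upwards [h.filter_mono nhdsWithin_le_nhds, self_mem_nhdsWithin] with t h1 h2
  rw [h1]
  exact mul_ne_zero hc (pow_ne_zero _ (sign_ne_zero.2 h2))

end Fibers

/-! ### Counting the intersections. -/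

section Intersections

variable {S : Type*} [TopologicalSpace S] [ChartedSpace (EuclideanSpace ℝ (Fin 2)) S]

/-- Otherwise `D` would kill both the tangent plane and the tangent line, which span `ℝ³`. -/
theorem CurveTransverse.apply_deriv_ne_zero {γ : ℝ → EuclideanSpace ℝ (Fin 3)}
    {f : S → EuclideanSpace ℝ (Fin 3)} (h : CurveTransverse γ f) {t : ℝ} {x : S}
    (htx : γ t = f x) {D : EuclideanSpace ℝ (Fin 3) →L[ℝ] ℝ} (hD0 : D ≠ 0)
    (hDf : ∀ v, D ((mfderiv (𝓡 2) 𝓘(ℝ, EuclideanSpace ℝ (Fin 3)) f x :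
        EuclideanSpace ℝ (Fin 2) →L[ℝ] EuclideanSpace ℝ (Fin 3)) v) = 0) :
    D (deriv γ t) ≠ 0 := by
  intro h0
  have hle : (⊤ : Submodule ℝ (EuclideanSpace ℝ (Fin 3))) ≤
      LinearMap.ker (D : EuclideanSpace ℝ (Fin 3) →ₗ[ℝ] ℝ) := by
    rw [← h t x htx]
    refine sup_le ?_ ?_
    · rw [Submodule.span_singleton_le_iff_mem]
      exact h0
    · rintro _ ⟨v, rfl⟩
      exact hDf v
  exact hD0 (ContinuousLinearMap.ext fun w => hle (Submodule.mem_top (x := w)))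

theorem ncard_intersectionPairs_eq_sum {S : Type*} {γ : ℝ → EuclideanSpace ℝ (Fin 3)}
    {f : S → EuclideanSpace ℝ (Fin 3)} (hpairs : (intersectionPairs γ f).Finite)
    (hfin : ∀ p, (f ⁻¹' {p}).Finite) :
    (intersectionPairs γ f).ncard =
      ∑ t ∈ hpairs.toFinset.image Prod.fst, (hfin (γ t)).toFinset.card := by
  classical
  rw [ncard_eq_toFinset_card _ hpairs,
    Finset.card_eq_sum_card_fiberwise (f := Prod.fst) (t := hpairs.toFinset.image Prod.fst)
      (fun p hp => Finset.mem_coe.2 (Finset.mem_image_of_mem _ hp))]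
  refine Finset.sum_congr rfl fun t ht => ?_
  rw [← Finset.card_image_of_injective (hfin (γ t)).toFinset (Prod.mk_right_injective t)]
  refine congrArg Finset.card ?_
  obtain ⟨p, hp, rfl⟩ := Finset.mem_image.1 ht
  have hp1 : p.1 ∈ Ico (0 : ℝ) 1 := ((Finite.mem_toFinset _).1 hp).1
  ext ⟨s, x⟩
  simp only [Finset.mem_filter, Finite.mem_toFinset, Finset.mem_image, Prod.mk.injEq,
    mem_preimage, mem_singleton_iff]
  constructor
  · rintro ⟨⟨-, h2⟩, rfl⟩
    exact ⟨x, h2.symm, rfl, rfl⟩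
  · rintro ⟨y, hy, rfl, rfl⟩
    exact ⟨⟨hp1, hy.symm⟩, rfl⟩

theorem even_ncard_intersectionPairs [CompactSpace S] [T2Space S]
    {f : S → EuclideanSpace ℝ (Fin 3)}
    (hf : IsImmersion (𝓡 2) 𝓘(ℝ, EuclideanSpace ℝ (Fin 3)) ∞ f)
    {γ : ℝ → EuclideanSpace ℝ (Fin 3)} (hγ : IsSmoothClosedCurve γ)
    (htrans : CurveTransverse γ f) :
    (intersectionPairs γ f).Finite ∧ Even (intersectionPairs γ f).ncard := by
  have hfc : Continuous f := continuous_iff_continuousAt.2 fun x => (hf.isImmersionAt x).continuousAt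
  have hγc : Continuous γ := hγ.contDiff.continuous
  have hγd : ∀ t, HasDerivAt γ (deriv γ t) t := fun t =>
    (hγ.contDiff.differentiable (by simp) t).hasDerivAt
  choose φ U D hU hxU hinj hdef hD hD0 hDf using fun x => (hf.isImmersionAt x).exists_isDefiningAt
  have hφ : ∀ x, φ x (f x) = 0 := fun x => (hdef x x (hxU x)).map_eq_zero.self_of_nhds
  have hfin := hfc.finite_fiber_of_locally_injOn fun x => ⟨U x, (hU x).mem_nhds (hxU x), hinj x⟩
  have hDγ : ∀ t x, f x = γ t → D x (deriv γ t) ≠ 0 := fun t x htx =>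
    htrans.apply_deriv_ne_zero htx.symm (hD0 x) (hDf x)
  have hpairs : (intersectionPairs γ f).Finite := by
    have hK : IsCompact {p : ℝ × S | p.1 ∈ Icc (0 : ℝ) 1 ∧ γ p.1 = f p.2} := by
      have h1 : IsCompact (Icc (0 : ℝ) 1 ×ˢ (univ : Set S)) := isCompact_Icc.prod isCompact_univ
      have h2 : IsClosed {p : ℝ × S | γ p.1 = f p.2} :=
        isClosed_eq (hγc.comp continuous_fst) (hfc.comp continuous_snd)
      refine (h1.inter_right h2).of_isClosed_subset ?_ ?_
      · exact (isClosed_Icc.preimage continuous_fst).inter h2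
      · exact fun p hp => ⟨⟨hp.1, mem_univ _⟩, hp.2⟩
    refine (hK.finite_of_subsingleton_inter ?_).subset fun p hp => ⟨Ico_subset_Icc_self hp.1, hp.2⟩
    rintro ⟨t₀, x⟩ ⟨-, htx⟩
    have htx : γ t₀ = f x := htx
    have hd : HasDerivAt (fun t => φ x (γ t)) (D x (deriv γ t₀)) t₀ :=
      HasFDerivAt.comp_hasDerivAt t₀ (htx ▸ hD x) (hγd t₀)
    have hsgn := hd.eventually_sign_eq (by rw [htx, hφ x]) (hDγ t₀ x htx.symm)
    -- Intersections are isolated: a nearby pair has `φ x (γ t) = 0`, which forces `t = t₀`, and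
    -- injectivity of `f` on `U x` then fixes the point.
    refine ⟨_, prod_mem_nhds hsgn ((hU x).mem_nhds (hxU x)), ?_⟩
    have key : ∀ p ∈ {p : ℝ × S | p.1 ∈ Icc (0 : ℝ) 1 ∧ γ p.1 = f p.2} ∩
        {t | sign (φ x (γ t)) = sign (D x (deriv γ t₀)) * sign (t - t₀)} ×ˢ U x,
        p = (t₀, x) := by
      rintro ⟨t, y⟩ ⟨⟨-, hty⟩, hs, hy⟩
      have hty : γ t = f y := hty
      have hs : sign (φ x (γ t)) = sign (D x (deriv γ t₀)) * sign (t - t₀) := hs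
      rw [hty, (hdef x y hy).map_eq_zero.self_of_nhds, sign_zero, eq_comm, mul_eq_zero,
        sign_eq_zero_iff, sign_eq_zero_iff, sub_eq_zero] at hs
      obtain rfl := hs.resolve_left (hDγ t₀ x htx.symm)
      have hyx : y = x := hinj x hy (hxU x) (hty.symm.trans htx)
      rw [hyx]
    exact fun p hp q hq => (key p hp).trans (key q hq).symm
  refine ⟨hpairs, ?_⟩
  obtain ⟨R, hR⟩ : ∃ R, ∀ t, γ t ∈ Metric.ball (0 : EuclideanSpace ℝ (Fin 3)) R := by
    have hcomp : IsCompact (range γ) := by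
      rw [← hγ.periodic.image_Icc one_pos 0]
      exact isCompact_Icc.image hγc
    obtain ⟨R, hR⟩ := hcomp.isBounded.subset_ball 0
    exact ⟨R, fun t => hR (mem_range_self t)⟩
  obtain ⟨s, hs⟩ := exists_sign_function_on_ball
    (fiberSign_signGermEq hfc hfin hU hxU hinj hdef)
    (fiberSign_frequently_ne_zero hfin hφ hD hD0) R
  rw [ncard_intersectionPairs_eq_sum hpairs hfin]
  -- The vanishing order at `t` is the number of surface points above `γ t`, so the total order
  -- counts the intersection pairs.
  refine even_sum_of_periodic_sign (g := s ∘ γ) (k := fun t => (hfin (γ t)).toFinset.card)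
    (hγ.periodic.comp s) (fun t => by simp only [hγ.periodic t]) ?_ ?_ ?_
  · intro t ht
    obtain ⟨p, hp, rfl⟩ := Finset.mem_image.1 ht
    exact ((Finite.mem_toFinset _).1 hp).1
  · intro t ht hnot
    rw [Finset.card_eq_zero, Finset.eq_empty_iff_forall_notMem]
    intro x hx
    refine hnot (Finset.mem_image.2 ⟨(t, x), (Finite.mem_toFinset _).2 ⟨ht, ?_⟩, rfl⟩)
    exact ((Finite.mem_toFinset _).1 hx).symm
  · intro t₀
    obtain ⟨c, hc, h⟩ := hs (γ t₀) (hR t₀)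
    obtain ⟨d, hd, h'⟩ := fiberSign_comp_curve hfin hφ hD (hγd t₀) (hDγ t₀)
    refine ⟨c * d, mul_ne_zero hc hd, Eventually.filter_mono nhdsWithin_le_nhds ?_⟩
    filter_upwards [hγc.continuousAt.eventually h, h'] with t h1 h2
    rw [Function.comp_apply, h1, h2, mul_assoc]

theorem image_intersectionPairs {S : Type*} {γ : ℝ → EuclideanSpace ℝ (Fin 3)}
    (hγ : Function.Periodic γ 1) (f : S → EuclideanSpace ℝ (Fin 3)) :
    (fun p : ℝ × S => f p.2) '' intersectionPairs γ f = range γ ∩ range f := by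
  ext z
  constructor
  · rintro ⟨p, hp, rfl⟩
    exact ⟨⟨p.1, hp.2⟩, p.2, rfl⟩
  · rintro ⟨⟨t, rfl⟩, x, hx⟩
    obtain ⟨t', ht', h⟩ := hγ.exists_mem_Ico₀ one_pos t
    exact ⟨(t', x), ⟨ht', h.symm.trans hx.symm⟩, hx⟩

end Intersections

theorem theorem2 {S : Type*} [TopologicalSpace S] [ChartedSpace (EuclideanSpace ℝ (Fin 2)) S]
    [IsManifold (𝓡 2) ∞ S] [CompactSpace S] [T2Space S]
    (f : S → EuclideanSpace ℝ (Fin 3))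
    (hf : IsImmersion (𝓡 2) 𝓘(ℝ, EuclideanSpace ℝ (Fin 3)) ∞ f)
    (γ : ℝ → EuclideanSpace ℝ (Fin 3)) (hγ : IsSmoothClosedCurve γ)
    (htrans : CurveTransverse γ f) :
    ((intersectionPairs γ f).Finite ∧ Even (intersectionPairs γ f).ncard) ∧
    (InjOn (fun p : ℝ × S => f p.2) (intersectionPairs γ f) →
      (range γ ∩ range f).Finite ∧ Even (range γ ∩ range f).ncard) := by
  have h := even_ncard_intersectionPairs hf hγ htrans
  refine ⟨h, fun hinj => ?_⟩
  rw [← image_intersectionPairs hγ.periodic f]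
  exact ⟨h.1.image _, by rw [hinj.ncard_image]; exact h.2⟩
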